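/- **Setting.** Monadic interaction logic has index variables of $n$ component types (countably many of each type), unary predicate symbols, and formulae $\phi ::= \bot \mid i=j \mid p(i) \mid \phi\wedge\phi \mid \neg\phi \mid \exists i.\,\phi$; $\top$, $\vee$ are the usual shorthands and an empty conjunction is $\top$. For a size function $\mathsf M:\{1,\dots,n\}\to\mathbb N$, a structure $\mathcal I=(\mathfrak U,\nu,\iota)$ has universe $\mathfrak U=\{1,\dots,\max_k \mathsf M(k)\}$, a valuation $\nu$ of the index variables in $\mathfrak U$, and an interpretation $\iota(p)\subseteq\mathfrak U$ of each predicate symbol; a variable of type $k$ is quantified over $\{1,\dots,\mathsf M(k)\}$. Put $\mathcal I\subseteq\mathcal I'$ if they have the same valuation and $\iota(p)\subseteq\iota'(p)$ for all $p$. A minimal model of $\phi$ is a model $\mathcal I$ such that no structure $\mathcal I'\subsetneq\mathcal I$ is a model; $\phi\equiv^{\mu}\psi$ means that, for every $\mathsf M$, $\phi$ and $\psi$ have the same minimal models. A formula is positive if predicate symbols occur in it only under an even number of negations. Boolean terms $t$ are built from predicate symbols by $\neg,\wedge,\vee$ and the constants $\top,\bot$ (empty conjunction and disjunction); $t(i)$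 is the formula obtained by applying each symbol to $i$, and $t\to t'$ means that the implication is propositionally valid. Fix a component type $k$. For $m\in\mathbb N$ let $|t|\ge m$ be the formula $\exists i_1\dots\exists i_m.\ \bigwedge_{a<b}\neg\, i_a=i_b\wedge\bigwedge_{a} t(i_a)$, with $i_1,\dots,i_m$ different variables of type $k$; let $|t|\le m$ be $\neg(|t|\ge m+1)$, and let $|t|\le\infty$ be $\top$. Let $\mathcal P$ be a finite set of predicate symbols. For $S\subseteq\mathcal P$ let $t_S^+=\bigwedge_{p\in S}p$, $t_S^-=\bigwedge_{p\in\mathcal P\setminus S}\neg p$, and let $t_S=t_S^+\wedge t_S^-$ be the complete minterm of $S$. Let $\mathrm{Pos}$ (resp. $\mathrm{Neg}$) be a finite set of terms built from the symbols $p\in\mathcal P$ (resp. from the literals $\neg p$, $p\in\mathcal P$) by $\wedge,\vee,\top,\bot$ that contains, up to propositional equivalence, every such term. **Lemma.** Let $\ell_S\in\mathbb N$ and $u_S\in\mathbb N\cup\{\infty\}$ with $\ell_S\le u_S$, for all $S\subseteq\mathcal P$, and let $$C=\bigwedge_{S\subseteq\mathcal P}\big(|t_S|\ge\ell_S\ \wedge\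 |t_S|\le u_S\big),$$ $$C^{\oplus}=\bigwedge_{\tau\in\mathrm{Pos}}\Big(|\tau|\ \ge\sum_{S\subseteq\mathcal P,\ t_S^+\to\tau}\ell_S\Big)\ \wedge\ \bigwedge_{\tau\in\mathrm{Neg}}\Big(|\tau|\ \le\sum_{S\subseteq\mathcal P,\ t_S^-\to\tau}u_S\Big).$$ Then $C^{\oplus}$ is a positive formula and $C\equiv^{\mu}C^{\oplus}$. -/

import Mathlib

namespace MIL

/-! ## Boolean terms -/

/-- Boolean terms over the predicate symbols. The constants `top` and `bot` are the empty
conjunction and the empty disjunction. -/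
inductive Term (Pred : Type*) where
  | top : Term Pred
  | bot : Term Pred
  | pred : Pred → Term Pred
  | neg : Term Pred → Term Pred
  | and : Term Pred → Term Pred → Term Pred
  | or : Term Pred → Term Pred → Term Pred

namespace Term

variable {Pred : Type*}

/-- Truth value of a term, each predicate symbol being read as a propositional variable. -/
def eval (v : Pred → Prop) : Term Pred → Prop
  | top => True
  | bot => False
  | pred p => v p
  | neg t => ¬ eval v t
  | and t₁ t₂ => eval v t₁ ∧ eval v t₂
  | or t₁ t₂ => eval v t₁ ∨ eval v t₂

/-- `t₁ → t₂`: the implication is propositionally valid. -/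
def Implies (t₁ t₂ : Term Pred) : Prop := ∀ v : Pred → Prop, t₁.eval v → t₂.eval v

/-- Propositional equivalence of terms. -/
def Equivalent (t₁ t₂ : Term Pred) : Prop := t₁.Implies t₂ ∧ t₂.Implies t₁

/-- Finite conjunction; the empty one is `top`. -/
def conj : List (Term Pred) → Term Pred
  | [] => top
  | t :: l => and t (conj l)

/-- The conjunction `t_S⁺` of the positive literals of the complete minterm of `S`. -/
noncomputable def mintermPos (S : Finset Pred) : Term Pred :=
  conj (S.toList.map pred)

/-- The conjunction `t_S⁻` of the negative literals of the complete minterm of `S`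
with respect to `P`. -/
noncomputable def mintermNeg [DecidableEq Pred] (P S : Finset Pred) : Term Pred :=
  conj ((P \ S).toList.map fun p => neg (pred p))

/-- The complete minterm `t_S` of `S` with respect to `P`. -/
noncomputable def minterm [DecidableEq Pred] (P S : Finset Pred) : Term Pred :=
  and (mintermPos S) (mintermNeg P S)

/-- The positive boolean combinations of the terms in `A`, i.e. those built from `A` by finite
(possibly empty) conjunctions and disjunctions. -/
inductive Combination (A : Set (Term Pred)) : Term Pred → Prop
  | top : Combination A top
  | bot : Combination A bot
  | atom {t : Term Pred} : t ∈ A → Combination A t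
  | and {t₁ t₂ : Term Pred} : Combination A t₁ → Combination A t₂ → Combination A (and t₁ t₂)
  | or {t₁ t₂ : Term Pred} : Combination A t₁ → Combination A t₂ → Combination A (or t₁ t₂)

/-- Positive boolean combinations of the symbols `p ∈ P`. -/
def posLang (P : Finset Pred) : Set (Term Pred) :=
  {t | Combination {a | ∃ p ∈ P, a = pred p} t}

/-- Positive boolean combinations of the literals `¬ p`, `p ∈ P`. -/
def negLang (P : Finset Pred) : Set (Term Pred) :=
  {t | Combination {a | ∃ p ∈ P, a = neg (pred p)} t}

/-- The finite set `T` is contained in `L` and contains every element of `L` up to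
propositional equivalence. -/
def Represents (T : Finset (Term Pred)) (L : Set (Term Pred)) : Prop :=
  (∀ t ∈ T, t ∈ L) ∧ ∀ t ∈ L, ∃ t' ∈ T, t.Equivalent t'

theorem eval_congr_of_combination {A : Set (Term Pred)} {v w : Pred → Prop}
    (h : ∀ a ∈ A, (a.eval v ↔ a.eval w)) {t : Term Pred} (ht : Combination A t) :
    t.eval v ↔ t.eval w := by
  induction ht with
  | top => exact Iff.rfl
  | bot => exact Iff.rfl
  | atom ha => exact h _ ha
  | and _ _ h₁ h₂ => exact and_congr h₁ h₂
  | or _ _ h₁ h₂ => exact or_congr h₁ h₂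

theorem exists_represents_aux (P : Finset Pred) (L : Set (Term Pred))
    (hL : ∀ t ∈ L, ∀ v w : Pred → Prop, (∀ p ∈ P, (v p ↔ w p)) → (t.eval v ↔ t.eval w)) :
    ∃ T, Represents T L := by
  classical
  let f : Term Pred → Set P.powerset := fun t => {S | t.eval (· ∈ (S : Finset Pred))}
  obtain ⟨T, hTL, hT⟩ := Set.exists_subset_bijOn L f
  have hfin : T.Finite := Set.Finite.of_finite_image (Set.toFinite _) hT.injOn
  refine ⟨hfin.toFinset, fun t ht => hTL (hfin.mem_toFinset.1 ht), fun t ht => ?_⟩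
  obtain ⟨t', ht', he⟩ := hT.surjOn (Set.mem_image_of_mem f ht)
  have key : ∀ v, t.eval v ↔ t'.eval v := by
    intro v
    let S : P.powerset := ⟨P.filter v, by simp⟩
    have hS : ∀ p ∈ P, (v p ↔ p ∈ (S : Finset Pred)) := by
      intro p hp; simp [S, hp]
    rw [hL t ht _ _ hS, hL t' (hTL ht') _ _ hS]
    exact (Set.ext_iff.1 he S).symm
  exact ⟨t', hfin.mem_toFinset.2 ht', fun v => (key v).1, fun v => (key v).2⟩

/-- Finite systems of representatives of the positive boolean combinations exist. -/
theorem exists_represents_posLang (P : Finset Pred) : ∃ T, Represents T (posLang P) := by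
  refine exists_represents_aux P _ fun t ht v w h => eval_congr_of_combination ?_ ht
  rintro _ ⟨p, hp, rfl⟩
  exact h p hp

theorem exists_represents_negLang (P : Finset Pred) : ∃ T, Represents T (negLang P) := by
  refine exists_represents_aux P _ fun t ht v w h => eval_congr_of_combination ?_ ht
  rintro _ ⟨p, hp, rfl⟩
  exact not_congr (h p hp)

end Term

/-! ## Monadic interaction logic -/

/-- Index variables of `n` component types: the variable `(k, j)` has type `k`. -/
abbrev Var (n : ℕ) : Type := Fin n × ℕ

/-- Formulae. No typing restriction is imposed on the atoms `p(i)`; formulae in which `p` and `i`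
always have the same component type are particular cases. -/
inductive Formula (n : ℕ) (Pred : Type*) where
  | bot : Formula n Pred
  | eq : Var n → Var n → Formula n Pred
  | atom : Pred → Var n → Formula n Pred
  | and : Formula n Pred → Formula n Pred → Formula n Pred
  | neg : Formula n Pred → Formula n Pred
  | ex : Var n → Formula n Pred → Formula n Pred

/-- The universe `[1, max_k M(k)]`. -/
abbrev Universe {n : ℕ} (M : Fin n → ℕ) : Type :=
  {m : ℕ // m ∈ Set.Icc 1 (Finset.univ.sup M)}

/-- Structures: a valuation of the index variables and an interpretation of the predicates. -/
@[ext]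
structure Struct {n : ℕ} (M : Fin n → ℕ) (Pred : Type*) where
  ν : Var n → Universe M
  ι : Pred → Set (Universe M)

namespace Struct

variable {n : ℕ} {M : Fin n → ℕ} {Pred : Type*}

/-- Pointwise inclusion of the interpretations, for a fixed valuation of the variables. -/
def Sub (I J : Struct M Pred) : Prop := I.ν = J.ν ∧ ∀ p, I.ι p ⊆ J.ι p

/-- Strict inclusion. -/
def SSub (I J : Struct M Pred) : Prop := I.Sub J ∧ I ≠ J

end Struct

namespace Formula

variable {n : ℕ} {Pred : Type*}

/-- `⊤`. -/
def top : Formula n Pred := neg bot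

/-- `φ ∨ ψ`, as a shorthand. -/
def or (φ ψ : Formula n Pred) : Formula n Pred := neg (and (neg φ) (neg ψ))

/-- Finite conjunction; the empty one is `⊤`. -/
def conj : List (Formula n Pred) → Formula n Pred
  | [] => top
  | φ :: l => and φ (conj l)

/-- A block `∃ i₁ … ∃ iₘ` of existential quantifiers. -/
def exs : List (Var n) → Formula n Pred → Formula n Pred
  | [], φ => φ
  | i :: l, φ => ex i (exs l φ)

/-- The given variables have pairwise different values. -/
def distinct : List (Var n) → Formula n Pred
  | [] => top
  | i :: l => and (conj (l.map fun j => neg (eq i j))) (distinct l)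

/-- The formula `t(i)`. -/
def ofTerm (i : Var n) : Term Pred → Formula n Pred
  | .top => top
  | .bot => bot
  | .pred p => atom p i
  | .neg t => neg (ofTerm i t)
  | .and t₁ t₂ => and (ofTerm i t₁) (ofTerm i t₂)
  | .or t₁ t₂ => or (ofTerm i t₁) (ofTerm i t₂)

/-- `m` different index variables of component type `k`. -/
def vars (k : Fin n) (m : ℕ) : List (Var n) := (List.range m).map fun j => (k, j)

/-- `|t| ≥ m`, with index variables of component type `k`. -/
def cardGe (k : Fin n) (t : Term Pred) (m : ℕ) : Formula n Pred :=
  exs (vars k m) (and (distinct (vars k m)) (conj ((vars k m).map fun i => ofTerm i t)))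

/-- `|t| ≤ m`, with index variables of component type `k`; it is `⊤` for `m = ∞` and
`¬ (|t| ≥ m + 1)` otherwise. -/
def cardLe (k : Fin n) (t : Term Pred) (m : ℕ∞) : Formula n Pred :=
  if m = ⊤ then top else neg (cardGe k t (m.toNat + 1))

/-- Every predicate symbol occurs under an even (`b = true`) or odd (`b = false`) number of
negations. -/
def Polarity : Bool → Formula n Pred → Prop
  | _, bot => True
  | _, eq _ _ => True
  | b, atom _ _ => b = true
  | b, and φ ψ => Polarity b φ ∧ Polarity b ψ
  | b, neg φ => Polarity (!b) φ
  | b, ex _ φ => Polarity b φ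

/-- Positive formulae: predicate symbols occur only under an even number of negations. -/
def IsPositive (φ : Formula n Pred) : Prop := Polarity true φ

/-- Satisfaction; an index variable of component type `k` is quantified over `[1, M(k)]`. -/
def Sat {M : Fin n → ℕ} (ι : Pred → Set (Universe M)) : (Var n → Universe M) → Formula n Pred → Prop
  | _, bot => False
  | ν, eq i j => ν i = ν j
  | ν, atom p i => ν i ∈ ι p
  | ν, and φ ψ => Sat ι ν φ ∧ Sat ι ν ψ
  | ν, neg φ => ¬ Sat ι ν φ
  | ν, ex i φ => ∃ m : Universe M, (m : ℕ) ≤ M i.1 ∧ Sat ι (Function.update ν i m) φ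

/-- The set of models. -/
def models (M : Fin n → ℕ) (φ : Formula n Pred) : Set (Struct M Pred) :=
  {I | Sat I.ι I.ν φ}

/-- The set of minimal models. -/
def minModels (M : Fin n → ℕ) (φ : Formula n Pred) : Set (Struct M Pred) :=
  {I | I ∈ models M φ ∧ ∀ J : Struct M Pred, J.SSub I → J ∉ models M φ}

/-- `φ ≡μ ψ`: for all sizes `M(1), …, M(n)`, the same minimal models. -/
def MinEquiv (φ ψ : Formula n Pred) : Prop :=
  ∀ M : Fin n → ℕ, minModels M φ = minModels M ψ

/-! ## Positivation -/

/-- The conjunction of `ℓ_S ≤ |t_S|` and `|t_S| ≤ u_S` over all `S ⊆ P`. -/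
noncomputable def bounds [DecidableEq Pred] (k : Fin n) (P : Finset Pred)
    (ℓ : Finset Pred → ℕ) (u : Finset Pred → ℕ∞) : Formula n Pred :=
  conj (P.powerset.toList.map fun S =>
    and (cardGe k (Term.minterm P S) (ℓ S)) (cardLe k (Term.minterm P S) (u S)))

open Classical in
/-- The conjunction of `|τ| ≥ ∑ {ℓ_S | t_S⁺ → τ}` for `τ ∈ T` and of
`|τ| ≤ ∑ {u_S | t_S⁻ → τ}` for `τ ∈ T'`. -/
noncomputable def ppos (k : Fin n) (P : Finset Pred)
    (ℓ : Finset Pred → ℕ) (u : Finset Pred → ℕ∞) (T T' : Finset (Term Pred)) :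
    Formula n Pred :=
  and
    (conj (T.toList.map fun τ =>
      cardGe k τ (∑ S ∈ P.powerset with (Term.mintermPos S).Implies τ, ℓ S)))
    (conj (T'.toList.map fun τ =>
      cardLe k τ (∑ S ∈ P.powerset with (Term.mintermNeg P S).Implies τ, u S)))

end Formula

end MIL

namespace MIL

open Finset

/-! Label each element in the range of type `k` by the set of symbols of `P` that hold at it. A
model of `C` is a structure whose label fibres have sizes between `ℓ_S` and `u_S`. A positive term
selects an upper set of labels and a negative one a lower set, so summing fibre sizes shows that `C`
implies `C⊕`.

The converse fails, but every model of `C⊕` contains a model of `C`: it suffices to replace each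
label by one of its subsets so that the fibre sizes obey the bounds. This is a bipartite assignment
problem, solvable by Hall's theorem (`exists_assignment`) under two conditions on each set `A` of
elements: `A` fits into the capacities `u_S` of the sets below its labels, and the demands `ℓ_S` of
all other sets can be met outside `A`. The upper bounds of `C⊕`, for the lower set generated by the
labels of `A`, give the first; its lower bounds, for the complementary upper set, give the second
(`exists_sub_mem_models_bounds`). Equality of minimal models is then pure order theory
(`minModels_eq_of_exists_sub`). -/

/-! ## A degree-constrained assignment -/

/-- Assignment with lower and upper bounds on the fibres, from Hall's marriage theorem. -/
theorem exists_assignment {α β : Type*} [Fintype α] [DecidableEq α] [DecidableEq β]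
    (Q : Finset β) (N : α → Finset β) (hN : ∀ a, N a ⊆ Q) (l u : β → ℕ)
    (hlu : ∀ S ∈ Q, l S ≤ u S)
    (hu : ∀ A : Finset α, #A ≤ ∑ S ∈ A.biUnion N, u S)
    (hl : ∀ A : Finset α, ∑ S ∈ Q \ A.biUnion N, l S ≤ #Aᶜ) :
    ∃ g : α → β, (∀ a, g a ∈ N a) ∧
      ∀ S ∈ Q, l S ≤ #{a | g a = S} ∧ #{a | g a = S} ≤ u S := by
  -- Each `S` offers `u S` slots. Those of index below `l S` are mandatory; the others form `opt`
  -- and may stay free of elements of `α`.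
  let slots : Finset β → Finset (Σ _ : β, ℕ) := fun B => B.sigma fun S => range (u S)
  let opt : Finset (Σ _ : β, ℕ) := Q.sigma fun S => Ico (l S) (u S)
  have hslots : ∀ B, #(slots B) = ∑ S ∈ B, u S := fun B => by simp [slots]
  have hopt : #opt = ∑ S ∈ Q, (u S - l S) := by simp [opt]
  have hsub : ∀ A : Finset α, A.biUnion N ⊆ Q := fun A => biUnion_subset.2 fun a _ => hN a
  have hsum : ∑ S ∈ Q, u S = #opt + ∑ S ∈ Q, l S := by
    rw [hopt, ← sum_add_distrib]
    exact sum_congr rfl fun S hS => (Nat.sub_add_cancel (hlu S hS)).symm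
  have hcard : Fintype.card α ≤ ∑ S ∈ Q, u S :=
    (hu univ).trans (sum_le_sum_of_subset (hsub _))
  -- As many dummies as there are slots left over by `α`. Dummies accept optional slots only, so a
  -- perfect matching puts elements of `α` in all mandatory slots.
  let e := (∑ S ∈ Q, u S) - Fintype.card α
  let t : α ⊕ Fin e → Finset (Σ _ : β, ℕ) := Sum.elim (fun a => slots (N a)) fun _ => opt
  have hall : ∀ X : Finset (α ⊕ Fin e), #X ≤ #(X.biUnion t) := by
    intro X
    have hX : #X.toLeft + #X.toRight = #X := card_toLeft_add_card_toRight
    have hleft : slots (X.toLeft.biUnion N) ⊆ X.biUnion t := by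
      rintro ⟨S, j⟩ h
      simp only [slots, mem_sigma, mem_biUnion, mem_toLeft] at h
      obtain ⟨⟨a, ha, hS⟩, hj⟩ := h
      exact mem_biUnion.2 ⟨_, ha, by simpa [t, slots, hS] using hj⟩
    -- Without dummies, `hu` is Hall's condition. With a dummy, all of `opt` is available, and so
    -- are the mandatory slots over `N(A)`, where `A = X.toLeft`. Their number is `∑_Q u - ∑_{Q \
    -- N(A)} l ≥ ∑_Q u - #Aᶜ = #A + e`.
    rcases X.toRight.eq_empty_or_nonempty with h0 | ⟨i, hi⟩
    · rw [← hX, h0, card_empty, add_zero]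
      exact (hu _).trans ((hslots _).symm.le.trans (card_le_card hleft))
    · have hright : opt ⊆ X.biUnion t := fun x hx =>
        mem_biUnion.2 ⟨Sum.inr i, mem_toRight.1 hi, hx⟩
      let mand : Finset (Σ _ : β, ℕ) := (X.toLeft.biUnion N).sigma fun S => range (l S)
      have hmand : mand ⊆ slots (X.toLeft.biUnion N) := by
        rintro ⟨S, j⟩ h
        simp only [mand, slots, mem_sigma, mem_range] at h ⊢
        exact ⟨h.1, h.2.trans_le (hlu S (hsub _ h.1))⟩
      have hdisj : Disjoint opt mand := by
        rw [disjoint_left]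
        rintro ⟨S, j⟩ h h'
        simp only [opt, mand, mem_sigma, mem_Ico, mem_range] at h h'
        omega
      have h1 : #opt + #mand ≤ #(X.biUnion t) := by
        rw [← card_union_of_disjoint hdisj]
        exact card_le_card (union_subset hright (hmand.trans hleft))
      have h2 : #mand = ∑ S ∈ X.toLeft.biUnion N, l S := by simp [mand]
      have h3 := hl X.toLeft
      have h4 := sum_sdiff (f := l) (hsub X.toLeft)
      have h5 : #X.toRight ≤ e := by simpa using card_le_univ X.toRight
      have h6 := card_add_card_compl X.toLeft
      omega
  obtain ⟨f, hf, hft⟩ := (Finset.all_card_le_biUnion_card_iff_exists_injective t).1 hall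
  have hfl : ∀ a, (f (Sum.inl a)).1 ∈ N a ∧ (f (Sum.inl a)).2 < u (f (Sum.inl a)).1 := by
    intro a
    simpa [t, slots] using hft (Sum.inl a)
  have hfr : ∀ i, (f (Sum.inr i)).1 ∈ Q ∧ l (f (Sum.inr i)).1 ≤ (f (Sum.inr i)).2 ∧
      (f (Sum.inr i)).2 < u (f (Sum.inr i)).1 := by
    intro i
    simpa [t, opt] using hft (Sum.inr i)
  -- By the choice of `e`, both sides of the matching have the same size, so every slot is filled.
  have himage : univ.image f = slots Q := by
    refine eq_of_subset_of_card_le ?_ ?_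
    · rintro x hx
      obtain ⟨a | i, -, rfl⟩ := mem_image.1 hx
      · simpa [slots] using ⟨hN _ (hfl a).1, (hfl a).2⟩
      · simpa [slots] using ⟨(hfr i).1, (hfr i).2.2⟩
    · rw [card_image_of_injective _ hf, hslots]
      simp only [card_univ, Fintype.card_sum, Fintype.card_fin, e]
      omega
  refine ⟨fun a => (f (Sum.inl a)).1, fun a => (hfl a).1, fun S hS => ⟨?_, ?_⟩⟩
  · have : range (l S) ⊆ ({a | (f (Sum.inl a)).1 = S} : Finset α).image
        fun a => (f (Sum.inl a)).2 := by
      intro j hj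
      have hj' := mem_range.1 hj
      have : (⟨S, j⟩ : Σ _ : β, ℕ) ∈ univ.image f := by
        rw [himage]
        simpa [slots, hS] using hj'.trans_le (hlu S hS)
      obtain ⟨a | i, -, h⟩ := mem_image.1 this
      · exact mem_image.2 ⟨a, by simp [h], by simp [h]⟩
      · have := (hfr i).2.1
        rw [h] at this
        exact absurd hj' this.not_gt
    simpa using (card_le_card this).trans card_image_le
  · have h := card_le_card_of_injOn (s := ({a | (f (Sum.inl a)).1 = S} : Finset α))
      (t := range (u S)) (fun a => (f (Sum.inl a)).2) ?_ ?_
    · simpa using h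
    · intro a ha
      have ha' : (f (Sum.inl a)).1 = S := by simpa using ha
      simpa [← ha'] using (hfl a).2
    · intro a ha b hb hab
      have ha' : (f (Sum.inl a)).1 = S := by simpa using ha
      have hb' : (f (Sum.inl b)).1 = S := by simpa using hb
      exact Sum.inl_injective (hf (Sigma.ext (ha'.trans hb'.symm) (heq_of_eq hab)))

/-- `exists_assignment` with upper bounds that may be infinite. -/
theorem exists_assignment_enat {α β : Type*} [Fintype α] [DecidableEq α] [DecidableEq β]
    (Q : Finset β) (N : α → Finset β) (hN : ∀ a, N a ⊆ Q) (l : β → ℕ) (u : β → ℕ∞)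
    (hlu : ∀ S ∈ Q, (l S : ℕ∞) ≤ u S)
    (hu : ∀ A : Finset α, (#A : ℕ∞) ≤ ∑ S ∈ A.biUnion N, u S)
    (hl : ∀ A : Finset α, ∑ S ∈ Q \ A.biUnion N, l S ≤ #Aᶜ) :
    ∃ g : α → β, (∀ a, g a ∈ N a) ∧
      ∀ S ∈ Q, l S ≤ #{a | g a = S} ∧ (#{a | g a = S} : ℕ∞) ≤ u S := by
  -- An infinite capacity becomes `l S + card α`: large enough for any set of elements, and still at
  -- least `l S`.
  let w : β → ℕ := fun S => if u S = ⊤ then l S + Fintype.card α else (u S).toNat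
  have hw : ∀ S, u S ≠ ⊤ → (w S : ℕ∞) = u S := fun S h => by
    simp [w, h]
  suffices h : (∀ S ∈ Q, l S ≤ w S) ∧ ∀ A : Finset α, #A ≤ ∑ S ∈ A.biUnion N, w S by
    obtain ⟨g, hg, h⟩ := exists_assignment Q N hN l w h.1 h.2 hl
    refine ⟨g, hg, fun S hS => ⟨(h S hS).1, ?_⟩⟩
    by_cases hS' : u S = ⊤
    · simp [hS']
    · rw [← hw S hS']
      exact_mod_cast (h S hS).2
  constructor
  · intro S hS
    by_cases hS' : u S = ⊤
    · simp [w, hS']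
    · have := hlu S hS
      rw [← hw S hS'] at this
      exact_mod_cast this
  · intro A
    by_cases hA : ∃ S ∈ A.biUnion N, u S = ⊤
    · obtain ⟨S, hS, hS'⟩ := hA
      calc #A ≤ Fintype.card α := card_le_univ A
        _ ≤ w S := by simp [w, hS']
        _ ≤ _ := single_le_sum_of_canonicallyOrdered hS
    · push Not at hA
      have := hu A
      rw [← sum_congr rfl fun S hS => hw S (hA S hS)] at this
      exact_mod_cast this

/-! ## Boolean terms -/

namespace Term

variable {Pred : Type*}

theorem eval_conj {v : Pred → Prop} {L : List (Term Pred)} :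
    (conj L).eval v ↔ ∀ t ∈ L, t.eval v := by
  induction L with
  | nil => simp [conj, eval]
  | cons t L ih => simp [conj, eval, ih]

/-- Finite disjunction; the empty one is `bot`. -/
def disj : List (Term Pred) → Term Pred
  | [] => bot
  | t :: L => or t (disj L)

theorem eval_disj {v : Pred → Prop} {L : List (Term Pred)} :
    (disj L).eval v ↔ ∃ t ∈ L, t.eval v := by
  induction L with
  | nil => simp [disj, eval]
  | cons t L ih => simp [disj, eval, ih]

theorem Combination.conj {A : Set (Term Pred)} {L : List (Term Pred)}
    (h : ∀ t ∈ L, Combination A t) : Combination A (conj L) := by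
  induction L with
  | nil => exact .top
  | cons t L ih =>
    exact .and (h t (by simp)) (ih fun t' ht' => h t' (by simp [ht']))

theorem Combination.disj {A : Set (Term Pred)} {L : List (Term Pred)}
    (h : ∀ t ∈ L, Combination A t) : Combination A (disj L) := by
  induction L with
  | nil => exact .bot
  | cons t L ih =>
    exact .or (h t (by simp)) (ih fun t' ht' => h t' (by simp [ht']))

theorem eval_mono_of_combination {A : Set (Term Pred)} {v w : Pred → Prop}
    (h : ∀ a ∈ A, a.eval v → a.eval w) {t : Term Pred} (ht : Combination A t) :
    t.eval v → t.eval w := by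
  induction ht with
  | top => exact id
  | bot => exact id
  | atom ha => exact h _ ha
  | and _ _ h₁ h₂ => exact And.imp h₁ h₂
  | or _ _ h₁ h₂ => exact Or.imp h₁ h₂

theorem eval_mono_of_mem_posLang {P : Finset Pred} {t : Term Pred} (ht : t ∈ posLang P)
    {v w : Pred → Prop} (h : ∀ p ∈ P, v p → w p) : t.eval v → t.eval w :=
  eval_mono_of_combination (by rintro _ ⟨p, hp, rfl⟩; exact h p hp) ht

theorem eval_anti_of_mem_negLang {P : Finset Pred} {t : Term Pred} (ht : t ∈ negLang P)
    {v w : Pred → Prop} (h : ∀ p ∈ P, w p → v p) : t.eval v → t.eval w :=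
  eval_mono_of_combination (by rintro _ ⟨p, hp, rfl⟩; exact mt (h p hp)) ht

theorem eval_mintermPos {S : Finset Pred} {v : Pred → Prop} :
    (mintermPos S).eval v ↔ ∀ p ∈ S, v p := by
  simp [mintermPos, eval_conj, eval]

/-- `S` is the least valuation satisfying `t_S⁺`, and `t` is monotone, so validity need only be
tested there. -/
theorem mintermPos_implies_iff {P S : Finset Pred} {t : Term Pred}
    (ht : t ∈ posLang P) : (mintermPos S).Implies t ↔ t.eval (· ∈ S) :=
  ⟨fun h => h _ (eval_mintermPos.2 fun _ hp => hp), fun h _ hv =>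
    eval_mono_of_mem_posLang ht (fun p _ hp => eval_mintermPos.1 hv p hp) h⟩

theorem mintermPos_mem_posLang {P S : Finset Pred} (hS : S ⊆ P) :
    mintermPos S ∈ posLang P := by
  refine Combination.conj fun t ht => .atom ?_
  obtain ⟨p, hp, rfl⟩ := List.mem_map.1 ht
  exact ⟨p, hS (mem_toList.1 hp), rfl⟩

theorem Represents.exists_eval_iff {T : Finset (Term Pred)} {L : Set (Term Pred)}
    (h : Represents T L) {t : Term Pred} (ht : t ∈ L) :
    ∃ t' ∈ T, ∀ v, t'.eval v ↔ t.eval v := by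
  obtain ⟨t', ht', he⟩ := h.2 t ht
  exact ⟨t', ht', fun v => ⟨he.2 v, he.1 v⟩⟩

/-- Every family of subsets of `P` generates an upper set defined by a term in `T`. -/
theorem exists_eval_iff_exists_subset {P : Finset Pred} {T : Finset (Term Pred)}
    (hT : Represents T (posLang P)) {F : Finset (Finset Pred)} (hF : F ⊆ P.powerset) :
    ∃ t ∈ T, ∀ v, t.eval v ↔ ∃ S ∈ F, ∀ p ∈ S, v p := by
  obtain ⟨t, ht, h⟩ := hT.exists_eval_iff (t := disj (F.toList.map mintermPos))
    (Combination.disj fun t ht => by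
      obtain ⟨S, hS, rfl⟩ := List.mem_map.1 ht
      exact mintermPos_mem_posLang (mem_powerset.1 (hF (mem_toList.1 hS))))
  exact ⟨t, ht, fun v => by simp [h, eval_disj, eval_mintermPos]⟩

section

variable [DecidableEq Pred]

theorem eval_mintermNeg {P S : Finset Pred} {v : Pred → Prop} :
    (mintermNeg P S).eval v ↔ ∀ p ∈ P, v p → p ∈ S := by
  simp only [mintermNeg, eval_conj, List.mem_map, mem_toList, mem_sdiff]
  constructor
  · intro h p hp hv
    by_contra hS
    exact h _ ⟨p, ⟨hp, hS⟩, rfl⟩ hv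
  · rintro h _ ⟨p, hp, rfl⟩ hv
    exact hp.2 (h p hp.1 hv)

theorem eval_minterm {P S : Finset Pred} (hS : S ⊆ P) {v : Pred → Prop} [DecidablePred v] :
    (minterm P S).eval v ↔ P.filter v = S := by
  simp only [minterm, eval, eval_mintermPos, eval_mintermNeg, Finset.ext_iff, mem_filter]
  constructor
  · exact fun h p => ⟨fun hp => h.2 p hp.1 hp.2, fun hp => ⟨hS hp, h.1 p hp⟩⟩
  · exact fun h => ⟨fun p hp => ((h p).2 hp).2, fun p hp hv => (h p).1 ⟨hp, hv⟩⟩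

/-- Dually, on `P` the set `S` is the greatest valuation satisfying `t_S⁻`, and `t` is antitone. -/
theorem mintermNeg_implies_iff {P S : Finset Pred} {t : Term Pred}
    (ht : t ∈ negLang P) : (mintermNeg P S).Implies t ↔ t.eval (· ∈ S) :=
  ⟨fun h => h _ (eval_mintermNeg.2 fun _ _ hp => hp), fun h _ hv =>
    eval_anti_of_mem_negLang ht (fun p hp hp' => eval_mintermNeg.1 hv p hp hp') h⟩

theorem mintermNeg_mem_negLang {P S : Finset Pred} : mintermNeg P S ∈ negLang P := by
  refine Combination.conj fun t ht => .atom ?_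
  obtain ⟨p, hp, rfl⟩ := List.mem_map.1 ht
  exact ⟨p, (mem_sdiff.1 (mem_toList.1 hp)).1, rfl⟩

/-- Every family of subsets of `P` generates a lower set defined by a term in `T`. -/
theorem exists_eval_iff_exists_superset {P : Finset Pred} {T : Finset (Term Pred)}
    (hT : Represents T (negLang P)) (F : Finset (Finset Pred)) :
    ∃ t ∈ T, ∀ v, t.eval v ↔ ∃ S ∈ F, ∀ p ∈ P, v p → p ∈ S := by
  obtain ⟨t, ht, h⟩ := hT.exists_eval_iff (t := disj (F.toList.map (mintermNeg P)))
    (Combination.disj fun t ht => by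
      obtain ⟨S, hS, rfl⟩ := List.mem_map.1 ht
      exact mintermNeg_mem_negLang)
  exact ⟨t, ht, fun v => by simp [h, eval_disj, eval_mintermNeg]⟩

end

end Term

namespace Formula

variable {n : ℕ} {Pred : Type*}

/-! ## Polarity -/

theorem polarity_top (b : Bool) : Polarity b (top : Formula n Pred) := trivial

theorem polarity_conj {b : Bool} {L : List (Formula n Pred)} (h : ∀ φ ∈ L, Polarity b φ) :
    Polarity b (conj L) := by
  induction L with
  | nil => exact polarity_top b
  | cons φ L ih => exact ⟨h φ (by simp), ih fun ψ hψ => h ψ (by simp [hψ])⟩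

theorem polarity_exs {b : Bool} {L : List (Var n)} {φ : Formula n Pred} (h : Polarity b φ) :
    Polarity b (exs L φ) := by
  induction L with
  | nil => exact h
  | cons i L ih => exact ih

theorem polarity_distinct {b : Bool} (L : List (Var n)) :
    Polarity b (distinct L : Formula n Pred) := by
  induction L with
  | nil => exact polarity_top b
  | cons i L ih =>
    refine ⟨polarity_conj fun φ hφ => ?_, ih⟩
    obtain ⟨j, -, rfl⟩ := List.mem_map.1 hφ
    trivial

theorem polarity_cardGe {b : Bool} {k : Fin n} {t : Term Pred} {m : ℕ}
    (h : ∀ i : Var n, Polarity b (ofTerm i t)) : Polarity b (cardGe k t m) := by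
  refine polarity_exs ⟨polarity_distinct _, polarity_conj fun φ hφ => ?_⟩
  obtain ⟨i, -, rfl⟩ := List.mem_map.1 hφ
  exact h i

/-- The negation in `|t| ≤ m` cancels the one in the literals `¬ p`, which is why upper bounds use
negative terms. -/
theorem polarity_cardLe {k : Fin n} {t : Term Pred} {m : ℕ∞}
    (h : ∀ i : Var n, Polarity false (ofTerm i t)) : Polarity true (cardLe k t m) := by
  unfold cardLe
  split_ifs
  · exact polarity_top _
  · exact polarity_cardGe h

theorem polarity_ofTerm {b : Bool} {A : Set (Term Pred)} {i : Var n}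
    (h : ∀ a ∈ A, Polarity b (ofTerm i a)) {t : Term Pred} (ht : Term.Combination A t) :
    Polarity b (ofTerm i t) := by
  induction ht with
  | top => exact polarity_top b
  | bot => trivial
  | atom ha => exact h _ ha
  | and _ _ h₁ h₂ => exact ⟨h₁, h₂⟩
  | or _ _ h₁ h₂ => simpa [ofTerm, or, Polarity] using And.intro h₁ h₂

theorem isPositive_ppos {k : Fin n} {P : Finset Pred} {l : Finset Pred → ℕ}
    {u : Finset Pred → ℕ∞} {T T' : Finset (Term Pred)}
    (hT : ∀ t ∈ T, t ∈ Term.posLang P) (hT' : ∀ t ∈ T', t ∈ Term.negLang P) :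
    (ppos k P l u T T').IsPositive := by
  classical
  refine ⟨polarity_conj fun φ hφ => ?_, polarity_conj fun φ hφ => ?_⟩ <;>
    obtain ⟨t, ht, rfl⟩ := List.mem_map.1 hφ
  · refine polarity_cardGe fun i => polarity_ofTerm ?_ (hT t (mem_toList.1 ht))
    rintro _ ⟨p, -, rfl⟩
    rfl
  · refine polarity_cardLe fun i => polarity_ofTerm ?_ (hT' t (mem_toList.1 ht))
    rintro _ ⟨p, -, rfl⟩
    rfl

/-! ## Satisfaction -/

section Sat

variable {M : Fin n → ℕ} {ι : Pred → Set (Universe M)} {ν : Var n → Universe M}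

theorem sat_conj {L : List (Formula n Pred)} : Sat ι ν (conj L) ↔ ∀ φ ∈ L, Sat ι ν φ := by
  induction L with
  | nil => simp [conj, top, Sat]
  | cons φ L ih => simp [conj, Sat, ih]

theorem sat_exs {L : List (Var n)} {φ : Formula n Pred} :
    Sat ι ν (exs L φ) ↔ ∃ ν' : Var n → Universe M, (∀ i ∉ L, ν' i = ν i) ∧
      (∀ i ∈ L, (ν' i : ℕ) ≤ M i.1) ∧ Sat ι ν' φ := by
  induction L generalizing ν with
  | nil =>
    simp only [exs, List.not_mem_nil, not_false_eq_true, forall_const, false_imp_iff]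
    constructor
    · exact fun h => ⟨ν, fun _ => rfl, fun _ => trivial, h⟩
    · rintro ⟨ν', h, -, h'⟩
      rwa [← funext h]
  | cons i L ih =>
    simp only [exs, Sat, ih]
    constructor
    · rintro ⟨m, hm, ν', h₁, h₂, h₃⟩
      refine ⟨ν', fun j hj => ?_, fun j hj => ?_, h₃⟩
      · rw [List.mem_cons, not_or] at hj
        rw [h₁ j hj.2, Function.update_of_ne hj.1]
      -- If `i` occurs again in `L`, the inner quantifier overrides the value `m`.
      · by_cases hjL : j ∈ L
        · exact h₂ j hjL
        · obtain rfl : j = i := (List.mem_cons.1 hj).resolve_right hjL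
          rwa [h₁ j hjL, Function.update_self]
    · rintro ⟨ν', h₁, h₂, h₃⟩
      refine ⟨ν' i, h₂ i (by simp), ν', fun j hj => ?_, fun j hj => h₂ j (by simp [hj]), h₃⟩
      by_cases hji : j = i
      · rw [hji, Function.update_self]
      · rw [Function.update_of_ne hji, h₁ j (by simp [hji, hj])]

theorem sat_distinct {L : List (Var n)} :
    Sat ι ν (distinct L) ↔ L.Pairwise fun i j => ν i ≠ ν j := by
  induction L with
  | nil => simp [distinct, top, Sat]
  | cons i L ih =>
    simp only [distinct, Sat, sat_conj, ih, List.forall_mem_map, List.pairwise_cons, ne_eq]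

theorem sat_ofTerm {i : Var n} {t : Term Pred} :
    Sat ι ν (ofTerm i t) ↔ t.eval fun p => ν i ∈ ι p := by
  induction t with
  | top => simp [ofTerm, top, Sat, Term.eval]
  | bot => simp [ofTerm, Sat, Term.eval]
  | pred p => simp [ofTerm, Sat, Term.eval]
  | neg t ih => simp [ofTerm, Sat, Term.eval, ih]
  | and t₁ t₂ h₁ h₂ => simp [ofTerm, Sat, Term.eval, h₁, h₂]
  | or t₁ t₂ h₁ h₂ =>
    simp only [ofTerm, or, Sat, Term.eval, h₁, h₂]
    tauto

/-- The elements over which the variables of component type `k` range. -/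
abbrev Range (M : Fin n → ℕ) (k : Fin n) : Type := {m : Universe M // (m : ℕ) ≤ M k}

noncomputable instance (M : Fin n → ℕ) (k : Fin n) : Fintype (Range M k) :=
  have : Finite (Universe M) := (Set.finite_Icc 1 (univ.sup M)).to_subtype
  Fintype.ofFinite _

open Classical in
-- Pairwise different values for the `m` variables amount to an injection of `Fin m` into the
-- elements satisfying `t`.
theorem sat_cardGe {k : Fin n} {t : Term Pred} {m : ℕ} :
    Sat ι ν (cardGe k t m) ↔ m ≤ #{a : Range M k | t.eval fun p => a.1 ∈ ι p} := by
  have hvars : ∀ i : Var n, i ∈ vars k m ↔ i.1 = k ∧ i.2 < m := by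
    rintro ⟨k', j⟩
    simp [vars, and_comm, eq_comm]
  simp only [cardGe, sat_exs, Sat, sat_distinct, sat_conj, List.forall_mem_map, sat_ofTerm]
  constructor
  · rintro ⟨ν', -, h₁, h₂, h₃⟩
    let f : Fin m → Range M k := fun j =>
      ⟨ν' (k, j), h₁ (k, j) ((hvars _).2 ⟨rfl, j.2⟩)⟩
    have hf : Function.Injective f := by
      have h : ∀ i j : Fin m, i < j → f i ≠ f j := by
        intro i j hij he
        rw [vars, List.pairwise_map, List.pairwise_iff_getElem] at h₂
        have := h₂ i j (by simp) (by simp) hij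
        simp only [List.getElem_range] at this
        exact this (congrArg Subtype.val he)
      intro i j hij
      by_contra hne
      rcases lt_or_gt_of_ne hne with hlt | hlt
      · exact h i j hlt hij
      · exact h j i hlt hij.symm
    calc m = #(univ.image f) := by simp [card_image_of_injective _ hf]
      _ ≤ _ := card_le_card fun a ha => by
        obtain ⟨j, -, rfl⟩ := mem_image.1 ha
        simpa using h₃ (k, j) ((hvars _).2 ⟨rfl, j.2⟩)
  · intro h
    obtain ⟨B, hB, hBm⟩ := exists_subset_card_eq h
    let f : Fin m ≃ B := (B.equivFinOfCardEq hBm).symm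
    refine ⟨fun i => if hi : i.1 = k ∧ i.2 < m then (f ⟨i.2, hi.2⟩).1.1 else ν i,
      fun i hi => ?_, fun i hi => ?_, ?_, fun i hi => ?_⟩
    · rw [hvars] at hi
      simp [hi]
    · rw [hvars] at hi
      simpa [hi] using (f ⟨i.2, hi.2⟩).1.2
    · rw [vars, List.pairwise_map, List.pairwise_iff_getElem]
      intro i j hi hj hij
      rw [List.length_range] at hi hj
      simp only [List.getElem_range, hi, hj, and_self, dite_true]
      intro he
      have := f.injective (Subtype.ext (Subtype.ext he))
      exact hij.ne (congrArg Fin.val this)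
    · rw [hvars] at hi
      simpa [hi] using hB (f ⟨i.2, hi.2⟩).2

open Classical in
theorem sat_cardLe {k : Fin n} {t : Term Pred} {m : ℕ∞} :
    Sat ι ν (cardLe k t m) ↔
      (#{a : Range M k | t.eval fun p => a.1 ∈ ι p} : ℕ∞) ≤ m := by
  unfold cardLe
  split_ifs with h
  · simp [h, top, Sat]
  · lift m to ℕ using h
    rw [Sat, sat_cardGe, ENat.toNat_natCast, Nat.cast_le]
    omega

end Sat

/-! ## Models -/

section Models

variable {M : Fin n → ℕ}

open Classical in
/-- The set of symbols of `P` that hold at `a`. -/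
noncomputable def label (P : Finset Pred) (ι : Pred → Set (Universe M)) {k : Fin n}
    (a : Range M k) : Finset Pred := {p ∈ P | a.1 ∈ ι p}

theorem mem_label {P : Finset Pred} {ι : Pred → Set (Universe M)} {k : Fin n}
    {a : Range M k} {p : Pred} : p ∈ label P ι a ↔ p ∈ P ∧ a.1 ∈ ι p := by
  classical
  rw [label, mem_filter]

theorem label_mem_powerset {P : Finset Pred} {ι : Pred → Set (Universe M)} {k : Fin n}
    (a : Range M k) : label P ι a ∈ P.powerset :=
  mem_powerset.2 fun _ hp => (mem_label.1 hp).1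

variable {k : Fin n} {P : Finset Pred} {l : Finset Pred → ℕ}
  {u : Finset Pred → ℕ∞} {T T' : Finset (Term Pred)}

theorem mem_models_bounds [DecidableEq Pred] {I : Struct M Pred} :
    I ∈ models M (bounds k P l u) ↔ ∀ S ∈ P.powerset,
      l S ≤ #{a : Range M k | label P I.ι a = S} ∧
        (#{a : Range M k | label P I.ι a = S} : ℕ∞) ≤ u S := by
  classical
  simp only [models, Set.mem_ofPred_eq, bounds, sat_conj, List.forall_mem_map, mem_toList]
  refine forall₂_congr fun S hS => ?_
  rw [Sat, sat_cardGe, sat_cardLe]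
  have : ∀ a : Range M k, (Term.minterm P S).eval (fun p => a.1 ∈ I.ι p) ↔
      label P I.ι a = S := fun a => by
    rw [Term.eval_minterm (mem_powerset.1 hS), label]
  simp only [this]

open Classical in
-- A term over `P` sees an element only through its label, and the implications from the half
-- minterms reduce to evaluation at `S`. Both sides of each bound thus concern the same family of
-- sets.
theorem mem_models_ppos (hT : ∀ t ∈ T, t ∈ Term.posLang P)
    (hT' : ∀ t ∈ T', t ∈ Term.negLang P) {I : Struct M Pred} :
    I ∈ models M (ppos k P l u T T') ↔
      (∀ t ∈ T, ∑ S ∈ P.powerset with t.eval (· ∈ S), l S ≤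
        #{a : Range M k | t.eval (· ∈ label P I.ι a)}) ∧
      ∀ t ∈ T', (#{a : Range M k | t.eval (· ∈ label P I.ι a)} : ℕ∞) ≤
        ∑ S ∈ P.powerset with t.eval (· ∈ S), u S := by
  simp only [models, Set.mem_ofPred_eq, ppos, Sat, sat_conj, List.forall_mem_map, mem_toList,
    sat_cardGe, sat_cardLe]
  refine and_congr (forall₂_congr fun t ht => ?_) (forall₂_congr fun t ht => ?_)
  · have h₁ : ∀ a : Range M k, t.eval (fun p => a.1 ∈ I.ι p) ↔
        t.eval (· ∈ label P I.ι a) := fun a =>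
      Term.eval_congr_of_combination
        (by rintro _ ⟨p, hp, rfl⟩; simp [Term.eval, mem_label, hp]) (hT t ht)
    rw [filter_congr fun S _ => Term.mintermPos_implies_iff (hT t ht)]
    simp only [h₁]
  · have h₁ : ∀ a : Range M k, t.eval (fun p => a.1 ∈ I.ι p) ↔
        t.eval (· ∈ label P I.ι a) := fun a =>
      Term.eval_congr_of_combination
        (by rintro _ ⟨p, hp, rfl⟩; simp [Term.eval, mem_label, hp]) (hT' t ht)
    rw [filter_congr fun S _ => @Term.mintermNeg_implies_iff _
      (fun a b => Classical.propDecidable (a = b)) P S t (hT' t ht)]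
    simp only [h₁]

theorem models_bounds_subset_models_ppos [DecidableEq Pred] (hT : ∀ t ∈ T, t ∈ Term.posLang P)
    (hT' : ∀ t ∈ T', t ∈ Term.negLang P) :
    models M (bounds k P l u) ⊆ models M (ppos k P l u T T') := by
  classical
  intro I hI
  rw [mem_models_bounds] at hI
  -- The elements satisfying `t` are partitioned by their labels.
  have hcard : ∀ t : Term Pred, #{a : Range M k | t.eval (· ∈ label P I.ι a)} =
      ∑ S ∈ P.powerset with t.eval (· ∈ S), #{a : Range M k | label P I.ι a = S} := by
    intro t
    rw [card_eq_sum_card_fiberwise (f := label P I.ι)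
      (t := P.powerset.filter fun S => t.eval (· ∈ S))]
    · refine sum_congr rfl fun S hS => ?_
      rw [filter_filter]
      congr 1
      refine filter_congr fun a _ => and_iff_right_of_imp ?_
      rintro rfl
      exact (mem_filter.1 hS).2
    · intro a ha
      simpa using ⟨mem_powerset.1 (label_mem_powerset a), by simpa using ha⟩
  rw [mem_models_ppos hT hT']
  refine ⟨fun t _ => ?_, fun t _ => ?_⟩
  · rw [hcard]
    exact sum_le_sum fun S hS => (hI S (mem_filter.1 hS).1).1
  · rw [hcard, Nat.cast_sum]
    exact sum_le_sum fun S hS => (hI S (mem_filter.1 hS).1).2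

theorem exists_sub_mem_models_bounds [DecidableEq Pred] (hlu : ∀ S ⊆ P, (l S : ℕ∞) ≤ u S)
    (hT : Term.Represents T (Term.posLang P)) (hT' : Term.Represents T' (Term.negLang P))
    {I : Struct M Pred} (hI : I ∈ models M (ppos k P l u T T')) :
    ∃ J ∈ models M (bounds k P l u), J.Sub I := by
  classical
  rw [mem_models_ppos hT.1 hT'.1] at hI
  have hN : ∀ a : Range M k, (label P I.ι a).powerset ⊆ P.powerset := fun a =>
    powerset_mono.2 (mem_powerset.1 (label_mem_powerset a))
  have hu : ∀ A : Finset (Range M k),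
      (#A : ℕ∞) ≤ ∑ S ∈ A.biUnion fun a => (label P I.ι a).powerset, u S := by
    intro A
    -- `t` defines the lower set generated by the labels of `A`; within `P` it consists of the sets
    -- allowed for some element of `A`.
    obtain ⟨t, ht, he⟩ := Term.exists_eval_iff_exists_superset hT' (A.image (label P I.ι))
    calc (#A : ℕ∞) ≤ #{a : Range M k | t.eval (· ∈ label P I.ι a)} := by
          refine Nat.cast_le.2 (card_le_card fun a ha => ?_)
          rw [mem_filter, he]
          exact ⟨mem_univ _, _, mem_image_of_mem _ ha, fun p _ hp => hp⟩
      _ ≤ _ := hI.2 t ht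
      _ ≤ _ := by
          refine sum_le_sum_of_subset fun S hS => ?_
          rw [mem_filter, he, mem_powerset] at hS
          obtain ⟨hSP, S', hS', h⟩ := hS
          obtain ⟨a, ha, rfl⟩ := mem_image.1 hS'
          exact mem_biUnion.2 ⟨a, ha, mem_powerset.2 fun p hp => h p (hSP hp) hp⟩
  have hl : ∀ A : Finset (Range M k),
      ∑ S ∈ P.powerset \ A.biUnion fun a => (label P I.ι a).powerset, l S ≤ #Aᶜ := by
    intro A
    -- `t` defines the upper set generated by the sets allowed for no element of `A`. No `a ∈ A`
    -- satisfies it, since its label would contain such a set, which would then be allowed for `a`.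
    obtain ⟨t, ht, he⟩ := Term.exists_eval_iff_exists_subset hT
      (sdiff_subset (s := P.powerset) (t := A.biUnion fun a => (label P I.ι a).powerset))
    refine (sum_le_sum_of_subset fun S hS => ?_).trans
      ((hI.1 t ht).trans (card_le_card fun a ha => ?_))
    · rw [mem_filter, he]
      exact ⟨(mem_sdiff.1 hS).1, S, hS, fun p hp => hp⟩
    · rw [mem_filter, he] at ha
      obtain ⟨-, S, hS, h⟩ := ha
      rw [mem_compl]
      exact fun haA => (mem_sdiff.1 hS).2 (mem_biUnion.2 ⟨a, haA, mem_powerset.2 h⟩)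
  obtain ⟨g, hg, hgc⟩ := exists_assignment_enat P.powerset
    (fun a : Range M k => (label P I.ι a).powerset) hN l u
    (fun S hS => hlu S (mem_powerset.1 hS)) hu hl
  have hgP : ∀ a, g a ⊆ label P I.ι a := fun a => mem_powerset.1 (hg a)
  -- `g` becomes the new labelling. All predicates are emptied beyond `M k`, where the bounds do not
  -- look.
  let J : Struct M Pred := ⟨I.ν, fun p => {x | ∃ h : (x : ℕ) ≤ M k, p ∈ g ⟨x, h⟩}⟩
  have hJ : ∀ a : Range M k, label P J.ι a = g a := by
    intro a
    ext p
    rw [mem_label]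
    exact ⟨fun h => h.2.2, fun h => ⟨(mem_label.1 (hgP a h)).1, a.2, h⟩⟩
  refine ⟨J, ?_, rfl, ?_⟩
  · rw [mem_models_bounds]
    simpa only [hJ] using hgc
  · rintro p x ⟨hx, hp⟩
    exact (mem_label.1 (hgP _ hp)).2

end Models

/-- A model of `ψ` strictly below a minimal model of `φ` would contain a model of `φ`, still
strictly below. A minimal model of `ψ` contains a model of `φ`, which is also a model of `ψ` and
hence equal to it. -/
theorem minModels_eq_of_exists_sub {M : Fin n → ℕ} {φ ψ : Formula n Pred}
    (h : models M φ ⊆ models M ψ) (h' : ∀ I ∈ models M ψ, ∃ J ∈ models M φ, J.Sub I) :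
    minModels M φ = minModels M ψ := by
  have htrans : ∀ {I J K : Struct M Pred}, I.Sub J → J.SSub K → I.SSub K := by
    rintro I J K hIJ ⟨hJK, hne⟩
    refine ⟨⟨hIJ.1.trans hJK.1, fun p => (hIJ.2 p).trans (hJK.2 p)⟩, ?_⟩
    rintro rfl
    exact hne (Struct.ext hJK.1 (funext fun p => (hJK.2 p).antisymm (hIJ.2 p)))
  ext I
  constructor
  · rintro ⟨hI, hmin⟩
    refine ⟨h hI, fun J hJI hJ => ?_⟩
    obtain ⟨K, hK, hKJ⟩ := h' J hJ
    exact hmin K (htrans hKJ hJI) hK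
  · rintro ⟨hI, hmin⟩
    refine ⟨?_, fun J hJI hJ => hmin J hJI (h hJ)⟩
    obtain ⟨J, hJ, hJI⟩ := h' I hI
    by_cases he : J = I
    · exact he ▸ hJ
    · exact absurd (h hJ) (hmin J ⟨hJI, he⟩)

end Formula

end MIL

theorem mainTheorem2 {n : ℕ} {Pred : Type*} [DecidableEq Pred] (k : Fin n) (P : Finset Pred)
    (ℓ : Finset Pred → ℕ) (u : Finset Pred → ℕ∞) (hℓu : ∀ S ⊆ P, (ℓ S : ℕ∞) ≤ u S)
    (T T' : Finset (MIL.Term Pred))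
    (hT : MIL.Term.Represents T (MIL.Term.posLang P))
    (hT' : MIL.Term.Represents T' (MIL.Term.negLang P)) :
    (MIL.Formula.ppos k P ℓ u T T').IsPositive ∧
      MIL.Formula.MinEquiv (MIL.Formula.bounds k P ℓ u) (MIL.Formula.ppos k P ℓ u T T') := by
  exact ⟨MIL.Formula.isPositive_ppos hT.1 hT'.1, fun _ => MIL.Formula.minModels_eq_of_exists_sub
    (MIL.Formula.models_bounds_subset_models_ppos hT.1 hT'.1)
    fun _ hI => MIL.Formula.exists_sub_mem_models_bounds hℓu hT hT' hI⟩
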